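/- All manifolds are smooth, real, finite-dimensional and without boundary. Let $\mathcal G \rightrightarrows X$ be a Lie groupoid with source $s$, target $t$, unit map $x\mapsto 1_x$ and multiplication $m(g,h)=gh$ (defined when $s(g)=t(h)$); in particular $s$ is a submersion. Let $E\to X$ be a representation of $\mathcal G$, that is, a smooth vector bundle with a smooth functorial action of the arrows by linear maps $g\cdot : E_{s(g)}\to E_{t(g)}$. Let $\omega\in\Omega^1(\mathcal G,t^*E)$ be a multiplicative form, that is, $$(m^*\omega)_{(g,h)}=(\mathrm{pr}_1^*\omega)_{(g,h)}+g\cdot(\mathrm{pr}_2^*\omega)_{(g,h)}\qquad\text{whenever } s(g)=t(h).$$ For $x\in X$ let $A_x=\ker(d_{1_x}s)$ be the fibre of the Lie algebroid of $\mathcal G$, and let $\mathfrak g(\omega)_x=\ker(\omega_{1_x})\cap\ker(d_{1_x}s)\subseteq A_x$ be the fibre of the symbol space of $\omega$. Let $\pi:P\to M$ be a (left) principal $\mathcal G$-bundle with moment map $\mu:P\to X$: $\mathcal G$ acts smoothly on the left on $P$ along the smooth map $\mu$, by $m_P(g,p)=g\cdot p$ defined when $s(g)=\mu(p)$; $\pi$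 is a $\mathcal G$-invariant surjective submersion; and $(g,p)\mapsto(g\cdot p,p)$ is a diffeomorphism $\mathcal G\,{}_s\!\times_\mu P\to P\times_M P$. Let $\theta\in\Omega^1(P,\mu^*E)$ be a form such that the action is multiplicative with respect to $\theta$ and $\omega$, that is, $$(m_P^*\theta)_{(g,p)}=(\mathrm{pr}_1^*\omega)_{(g,p)}+g\cdot(\mathrm{pr}_2^*\theta)_{(g,p)}\qquad\text{whenever } s(g)=\mu(p).$$ Then for every $p\in P$ the infinitesimal action $$a_p:A_{\mu(p)}\to T_pP,\qquad a_p(\alpha)=d_{1_{\mu(p)}}\big(g\mapsto g\cdot p\big)(\alpha)$$ (the differential of the orbit map $s^{-1}(\mu(p))\to P$) restricts to a linear isomorphism $$(\mu^*\mathfrak g(\omega))_p=\mathfrak g(\omega)_{\mu(p)}\;\xrightarrow{\ \cong\ }\;\ker(d_p\pi)\cap\ker(\theta_p).$$ -/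

import Mathlib

open scoped Manifold ContDiff

noncomputable section

/-! ### Smooth maps on embedded submanifolds

All subsets below on which smoothness is considered are embedded submanifolds (fibres of submersions
and fibred products along submersions).  A map on an embedded submanifold is smooth if and only if it
locally extends to a smooth map on an open subset of the ambient manifold, and its differential is
the restriction, to the tangent space of the submanifold, of the differential of any such extension.
-/

section Subsets

variable {E H N E' H' Q : Type*}
  [NormedAddCommGroup E] [NormedSpace ℝ E] [TopologicalSpace H] [TopologicalSpace N]
  [ChartedSpace H N]
  [NormedAddCommGroup E'] [NormedSpace ℝ E'] [TopologicalSpace H'] [TopologicalSpace Q]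
  [ChartedSpace H' Q]

/-- `F` is a smooth extension, on some open neighbourhood of `x` in the ambient manifold,
of the map `f` defined on the subset `S`. -/
def IsLocalExtension (I : ModelWithCorners ℝ E H) (J : ModelWithCorners ℝ E' H')
    {S : Set N} (f : S → Q) (x : S) (F : N → Q) : Prop :=
  ∃ U : Set N, IsOpen U ∧ (x : N) ∈ U ∧ ContMDiffOn I J ∞ F U ∧ ∀ y : S, (y : N) ∈ U → F y = f y

theorem IsLocalExtension.apply_eq {I : ModelWithCorners ℝ E H} {J : ModelWithCorners ℝ E' H'}
    {S : Set N} {f : S → Q} {x : S} {F : N → Q} (h : IsLocalExtension I J f x F) : F x = f x := by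
  obtain ⟨U, -, hx, -, hF⟩ := h
  exact hF x hx

/-- Smoothness of a map on an embedded submanifold `S`: local smooth extendability. -/
def SmoothOnSubset (I : ModelWithCorners ℝ E H) (J : ModelWithCorners ℝ E' H')
    {S : Set N} (f : S → Q) : Prop :=
  ∀ x : S, ∃ F : N → Q, IsLocalExtension I J f x F

open Classical in
/-- The differential at `x` of a smooth map `f` on an embedded submanifold `S`, computed with a local
smooth extension.  It is meaningful (independent of the extension) on vectors tangent to `S`, and it
is only ever applied to such vectors. -/
def subsetDeriv (I : ModelWithCorners ℝ E H) (J : ModelWithCorners ℝ E' H')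
    {S : Set N} (f : S → Q) (x : S) : TangentSpace I (x : N) →ₗ[ℝ] TangentSpace J (f x) :=
  if h : ∃ F : N → Q, IsLocalExtension I J f x F then
    (LinearEquiv.cast (R := ℝ) (M := fun q : Q => TangentSpace J q)
        h.choose_spec.apply_eq).toLinearMap ∘ₗ
      (mfderiv I J h.choose (x : N)).toLinearMap
  else 0

/-- A bijection between embedded submanifolds which is smooth in both directions. -/
def IsSubsetDiffeo (I : ModelWithCorners ℝ E H) (J : ModelWithCorners ℝ E' H')
    {S : Set N} {S' : Set Q} (Φ : S → S') : Prop :=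
  SmoothOnSubset I J (fun x => (Φ x : Q)) ∧
    ∃ Ψ : S' → S, Function.LeftInverse Ψ Φ ∧ Function.RightInverse Ψ Φ ∧
      SmoothOnSubset J I (fun y => (Ψ y : N))

end Subsets

/-- The fibred product `{(a, b) | f a = g b}`. -/
def fiberProd {A B C : Type*} (f : A → C) (g : B → C) : Set (A × B) :=
  {z | f z.1 = g z.2}

section Groupoids

variable (EG G EX X : Type*)
  [NormedAddCommGroup EG] [NormedSpace ℝ EG] [TopologicalSpace G] [ChartedSpace EG G]
  [NormedAddCommGroup EX] [NormedSpace ℝ EX] [TopologicalSpace X] [ChartedSpace EX X]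

/-- A Lie groupoid `G ⇉ X`, with source `s`, target `t`, unit `u`, inversion `inv` and multiplication
`mul (g, h) = g h`, defined when `s g = t h`. -/
structure LieGroupoid where
  s : G → X
  t : G → X
  u : X → G
  inv : G → G
  mul : fiberProd s t → G
  isSubmersion_s : Manifold.IsSubmersion 𝓘(ℝ, EG) 𝓘(ℝ, EX) ∞ s
  contMDiff_t : ContMDiff 𝓘(ℝ, EG) 𝓘(ℝ, EX) ∞ t
  contMDiff_u : ContMDiff 𝓘(ℝ, EX) 𝓘(ℝ, EG) ∞ u
  contMDiff_inv : ContMDiff 𝓘(ℝ, EG) 𝓘(ℝ, EG) ∞ inv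
  smooth_mul : SmoothOnSubset (𝓘(ℝ, EG).prod 𝓘(ℝ, EG)) 𝓘(ℝ, EG) mul
  s_u : ∀ x, s (u x) = x
  t_u : ∀ x, t (u x) = x
  s_inv : ∀ g, s (inv g) = t g
  t_inv : ∀ g, t (inv g) = s g
  s_mul : ∀ z : fiberProd s t, s (mul z) = s z.1.2
  t_mul : ∀ z : fiberProd s t, t (mul z) = t z.1.1
  mul_assoc : ∀ (g h k : G) (hgh : s g = t h) (hhk : s h = t k),
    mul ⟨(mul ⟨(g, h), hgh⟩, k), (s_mul ⟨(g, h), hgh⟩).trans hhk⟩ =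
      mul ⟨(g, mul ⟨(h, k), hhk⟩), hgh.trans (t_mul ⟨(h, k), hhk⟩).symm⟩
  u_mul : ∀ g, mul ⟨(u (t g), g), s_u _⟩ = g
  mul_u : ∀ g, mul ⟨(g, u (s g)), (t_u _).symm⟩ = g
  inv_mul : ∀ g, mul ⟨(inv g, g), s_inv g⟩ = u (s g)
  mul_inv : ∀ g, mul ⟨(g, inv g), (t_inv g).symm⟩ = u (t g)

end Groupoids

section Coefficients

variable {EX X : Type*} [NormedAddCommGroup EX] [NormedSpace ℝ EX] [TopologicalSpace X]
  [ChartedSpace EX X]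
  (F : Type*) [NormedAddCommGroup F] [NormedSpace ℝ F]
  (V : X → Type*) [TopologicalSpace (Bundle.TotalSpace F V)] [∀ x, AddCommGroup (V x)]
  [∀ x, Module ℝ (V x)] [∀ x, TopologicalSpace (V x)] [FiberBundle F V]

/-- A representation of a Lie groupoid on a vector bundle `V` over its base: a smooth functorial
action of the arrows by linear maps `V (s g) → V (t g)`. -/
structure LieGroupoid.Representation {EG G : Type*} [NormedAddCommGroup EG] [NormedSpace ℝ EG]
    [TopologicalSpace G] [ChartedSpace EG G] (𝒢 : LieGroupoid EG G EX X) where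
  act : ∀ g : G, V (𝒢.s g) →ₗ[ℝ] V (𝒢.t g)
  smooth_act : SmoothOnSubset (𝓘(ℝ, EG).prod (𝓘(ℝ, EX).prod 𝓘(ℝ, F))) (𝓘(ℝ, EX).prod 𝓘(ℝ, F))
    (fun z : fiberProd 𝒢.s (Bundle.TotalSpace.proj : Bundle.TotalSpace F V → X) =>
      (⟨𝒢.t z.1.1, act z.1.1 (LinearEquiv.cast (R := ℝ) (M := V) z.2.symm z.1.2.2)⟩ :
        Bundle.TotalSpace F V))
  act_u : ∀ (x : X) (v : V (𝒢.s (𝒢.u x))),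
    (⟨𝒢.t (𝒢.u x), act (𝒢.u x) v⟩ : Bundle.TotalSpace F V) = ⟨𝒢.s (𝒢.u x), v⟩
  act_mul : ∀ (z : fiberProd 𝒢.s 𝒢.t) (v : V (𝒢.s z.1.2)),
    (⟨𝒢.t (𝒢.mul z),
        act (𝒢.mul z) (LinearEquiv.cast (R := ℝ) (M := V) (𝒢.s_mul z).symm v)⟩ :
      Bundle.TotalSpace F V) =
    ⟨𝒢.t z.1.1, act z.1.1 (LinearEquiv.cast (R := ℝ) (M := V) z.2.symm (act z.1.2 v))⟩

variable (EX) in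
/-- A smooth 1-form on `N` with values in the pullback along `f : N → X` of the vector bundle `V`.
Smoothness is smoothness of the associated bundle map `TN → V` covering `f`. -/
structure PullbackOneForm (EN : Type*) {N : Type*} [NormedAddCommGroup EN] [NormedSpace ℝ EN]
    [TopologicalSpace N] [ChartedSpace EN N] [IsManifold 𝓘(ℝ, EN) ∞ N] (f : N → X) where
  toFun : ∀ n : N, TangentSpace 𝓘(ℝ, EN) n →L[ℝ] V (f n)
  smooth_toFun : ContMDiff 𝓘(ℝ, EN).tangent (𝓘(ℝ, EX).prod 𝓘(ℝ, F)) ∞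
    (fun v : TangentBundle 𝓘(ℝ, EN) N => (⟨f v.proj, toFun v.proj v.2⟩ : Bundle.TotalSpace F V))

end Coefficients

section Actions

variable {EG G EX X : Type*}
  [NormedAddCommGroup EG] [NormedSpace ℝ EG] [TopologicalSpace G] [ChartedSpace EG G]
  [NormedAddCommGroup EX] [NormedSpace ℝ EX] [TopologicalSpace X] [ChartedSpace EX X]

/-- A smooth left action of a Lie groupoid `𝒢` on a manifold `P` along a smooth moment map
`μ : P → X`; `smul (g, p) = g p` is defined when `s g = μ p`. -/
structure LieGroupoid.Action (𝒢 : LieGroupoid EG G EX X) (EP P : Type*)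
    [NormedAddCommGroup EP] [NormedSpace ℝ EP] [TopologicalSpace P] [ChartedSpace EP P] where
  μ : P → X
  smul : fiberProd 𝒢.s μ → P
  contMDiff_μ : ContMDiff 𝓘(ℝ, EP) 𝓘(ℝ, EX) ∞ μ
  smooth_smul : SmoothOnSubset (𝓘(ℝ, EG).prod 𝓘(ℝ, EP)) 𝓘(ℝ, EP) smul
  μ_smul : ∀ z : fiberProd 𝒢.s μ, μ (smul z) = 𝒢.t z.1.1
  u_smul : ∀ p, smul ⟨(𝒢.u (μ p), p), 𝒢.s_u _⟩ = p
  mul_smul : ∀ (g h : G) (p : P) (hgh : 𝒢.s g = 𝒢.t h) (hp : 𝒢.s h = μ p),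
    smul ⟨(𝒢.mul ⟨(g, h), hgh⟩, p), (𝒢.s_mul ⟨(g, h), hgh⟩).trans hp⟩ =
      smul ⟨(g, smul ⟨(h, p), hp⟩), hgh.trans (μ_smul ⟨(h, p), hp⟩).symm⟩

variable {𝒢 : LieGroupoid EG G EX X}
  {F : Type*} [NormedAddCommGroup F] [NormedSpace ℝ F]
  {V : X → Type*} [TopologicalSpace (Bundle.TotalSpace F V)] [∀ x, AddCommGroup (V x)]
  [∀ x, Module ℝ (V x)] [∀ x, TopologicalSpace (V x)] [FiberBundle F V]
  {EP P : Type*} [NormedAddCommGroup EP] [NormedSpace ℝ EP] [TopologicalSpace P]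
  [ChartedSpace EP P]

/-- Multiplicativity of `ω ∈ Ω¹(G, t^*V)`: `m^*ω = pr₁^*ω + g · pr₂^*ω` at every composable pair
`(g, h)`, tested on the vectors `(v, w)` tangent to the manifold of composable pairs, i.e. those with
`ds(v) = dt(w)`. -/
def LieGroupoid.IsMultiplicativeForm [IsManifold 𝓘(ℝ, EG) ∞ G] (ρ : 𝒢.Representation F V)
    (om : PullbackOneForm EX F V EG 𝒢.t) : Prop :=
  ∀ (g h : G) (hgh : 𝒢.s g = 𝒢.t h) (v : TangentSpace 𝓘(ℝ, EG) g) (w : TangentSpace 𝓘(ℝ, EG) h),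
    tangentMap 𝓘(ℝ, EG) 𝓘(ℝ, EX) 𝒢.s ⟨g, v⟩ = tangentMap 𝓘(ℝ, EG) 𝓘(ℝ, EX) 𝒢.t ⟨h, w⟩ →
    LinearEquiv.cast (R := ℝ) (M := V) (𝒢.t_mul ⟨(g, h), hgh⟩)
        (om.toFun (𝒢.mul ⟨(g, h), hgh⟩)
          (subsetDeriv (𝓘(ℝ, EG).prod 𝓘(ℝ, EG)) 𝓘(ℝ, EG) 𝒢.mul ⟨(g, h), hgh⟩ (v, w))) =
      om.toFun g v + ρ.act g (LinearEquiv.cast (R := ℝ) (M := V) hgh.symm (om.toFun h w))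

namespace LieGroupoid.Action

/-- Multiplicativity of an action with respect to `θ ∈ Ω¹(P, μ^*V)` and `ω ∈ Ω¹(G, t^*V)`:
`m_P^*θ = pr₁^*ω + g · pr₂^*θ` at every `(g, p)` with `s g = μ p`, tested on the vectors `(v, w)`
tangent to the fibred product, i.e. those with `ds(v) = dμ(w)`. -/
def IsMultiplicative [IsManifold 𝓘(ℝ, EG) ∞ G] [IsManifold 𝓘(ℝ, EP) ∞ P]
    (A : 𝒢.Action EP P) (ρ : 𝒢.Representation F V)
    (om : PullbackOneForm EX F V EG 𝒢.t) (θ : PullbackOneForm EX F V EP A.μ) : Prop :=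
  ∀ (g : G) (p : P) (hgp : 𝒢.s g = A.μ p)
    (v : TangentSpace 𝓘(ℝ, EG) g) (w : TangentSpace 𝓘(ℝ, EP) p),
    tangentMap 𝓘(ℝ, EG) 𝓘(ℝ, EX) 𝒢.s ⟨g, v⟩ = tangentMap 𝓘(ℝ, EP) 𝓘(ℝ, EX) A.μ ⟨p, w⟩ →
    LinearEquiv.cast (R := ℝ) (M := V) (A.μ_smul ⟨(g, p), hgp⟩)
        (θ.toFun (A.smul ⟨(g, p), hgp⟩)
          (subsetDeriv (𝓘(ℝ, EG).prod 𝓘(ℝ, EP)) 𝓘(ℝ, EP) A.smul ⟨(g, p), hgp⟩ (v, w))) =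
      om.toFun g v + ρ.act g (LinearEquiv.cast (R := ℝ) (M := V) hgp.symm (θ.toFun p w))

/-- The action makes `π : P → M` a (left) principal bundle: `π` is a surjective submersion, invariant
under the action, and `(g, p) ↦ (g p, p)` is a diffeomorphism from the fibred product of `s` and `μ`
onto `P ×_M P`. -/
structure IsPrincipal (A : 𝒢.Action EP P) {EM M : Type*} [NormedAddCommGroup EM]
    [NormedSpace ℝ EM] [TopologicalSpace M] [ChartedSpace EM M] (π : P → M) : Prop where
  surjective : Function.Surjective π
  isSubmersion : Manifold.IsSubmersion 𝓘(ℝ, EP) 𝓘(ℝ, EM) ∞ π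
  invariant : ∀ z : fiberProd 𝒢.s A.μ, π (A.smul z) = π z.1.2
  diffeo : IsSubsetDiffeo (𝓘(ℝ, EG).prod 𝓘(ℝ, EP)) (𝓘(ℝ, EP).prod 𝓘(ℝ, EP))
    (fun z : fiberProd 𝒢.s A.μ => (⟨(A.smul z, z.1.2), invariant z⟩ : fiberProd π π))

end LieGroupoid.Action

/-- The fibre at `x` of the Lie algebroid, `A_x = ker (d s)` at the unit `1_x`. -/
def LieGroupoid.algebroidFiber (𝒢 : LieGroupoid EG G EX X) (x : X) :
    Submodule ℝ (TangentSpace 𝓘(ℝ, EG) (𝒢.u x)) :=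
  (mfderiv 𝓘(ℝ, EG) 𝓘(ℝ, EX) 𝒢.s (𝒢.u x)).ker

/-- The fibre at `x` of the symbol space `𝔤(ω) = (ker ω ∩ ker ds)|_X`. -/
def LieGroupoid.symbolSpace [IsManifold 𝓘(ℝ, EG) ∞ G]
    (𝒢 : LieGroupoid EG G EX X) (om : PullbackOneForm EX F V EG 𝒢.t) (x : X) :
    Submodule ℝ (TangentSpace 𝓘(ℝ, EG) (𝒢.u x)) :=
  (om.toFun (𝒢.u x)).ker ⊓ 𝒢.algebroidFiber x

namespace LieGroupoid.Action

/-- The orbit map `g ↦ g p`, defined on the source fibre `s⁻¹(μ p)`. -/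
def orbitMap (A : 𝒢.Action EP P) (p : P) : {g : G | 𝒢.s g = A.μ p} → P :=
  fun g => A.smul ⟨(g, p), g.2⟩

/-- The infinitesimal action `a_p : A_{μ p} → T_p P`, the differential at the unit `1_{μ p}` of the
orbit map on the source fibre. -/
def infinitesimalAction (A : 𝒢.Action EP P) (p : P) :
    𝒢.algebroidFiber (A.μ p) →ₗ[ℝ] TangentSpace 𝓘(ℝ, EP) p :=
  (LinearEquiv.cast (R := ℝ) (M := fun q : P => TangentSpace 𝓘(ℝ, EP) q)
      (A.u_smul p)).toLinearMap ∘ₗ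
    subsetDeriv 𝓘(ℝ, EG) 𝓘(ℝ, EP) (A.orbitMap p) ⟨𝒢.u (A.μ p), 𝒢.s_u _⟩ ∘ₗ
    (𝒢.algebroidFiber (A.μ p)).subtype

end LieGroupoid.Action

/-- The space `𝔤_π(θ)_p = ker (d_p π) ∩ ker (θ_p)`. -/
def verticalKernel [IsManifold 𝓘(ℝ, EP) ∞ P] {μ : P → X}
    (θ : PullbackOneForm EX F V EP μ) {EM M : Type*} [NormedAddCommGroup EM]
    [NormedSpace ℝ EM] [TopologicalSpace M] [ChartedSpace EM M] (π : P → M) (p : P) :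
    Submodule ℝ (TangentSpace 𝓘(ℝ, EP) p) :=
  (mfderiv 𝓘(ℝ, EP) 𝓘(ℝ, EM) π p).ker ⊓ (θ.toFun p).ker

end Actions

end

/-!
The proof computes differentials along curves.  The differential `subsetDeriv` of a map on an
embedded submanifold is defined with a chosen local extension; on the velocity of a curve lying in
the submanifold it is the velocity of the image curve (`HasVelocity.subsetDeriv`), so there it does
not depend on the choice.  By the local normal form of a submersion, every vector in the kernel of
its differential is the velocity of a curve in the fibre
(`Manifold.IsSubmersionAt.exists_curve_in_fiber`).  This applies to the source map, whose fibres
carry the orbit maps, and to the projection `π`.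

Fix `p`, and let `a_p : A_{μ p} → T_p P` be the infinitesimal action.

* The orbit map takes values in a fibre of `π`, so `a_p` takes values in `ker (d_p π)`.
* `(g, p) ↦ (g p, p)` has a smooth inverse `Ψ`.  A curve `g_t` of arrows in the source fibre is the
  first component of `Ψ (g_t p, p)`, so its velocity is determined by that of `g_t p`: `a_p` is
  injective.  Conversely a curve `d_t` through `p` in a fibre of `π` equals `g_t p`, where `g_t` is
  the first component of `Ψ (d_t, p)`: `a_p` is onto `ker (d_p π)`.
* Multiplicativity of the action, tested on `(α, 0)` at `(1_{μ p}, p)`, reads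
  `θ (a_p α) = ω α`, up to the identification of the fibres over equal base points.  Hence `a_p`
  matches the kernel of `ω` with that of `θ`.
-/

/-! ### Differentials along curves -/

section Curves

open Filter Topology

variable {E H N E' H' Q : Type*}
  [NormedAddCommGroup E] [NormedSpace ℝ E] [TopologicalSpace H] [TopologicalSpace N]
  [ChartedSpace H N]
  [NormedAddCommGroup E'] [NormedSpace ℝ E'] [TopologicalSpace H'] [TopologicalSpace Q]
  [ChartedSpace H' Q]

/-- The curve `γ` is differentiable at time `0` with velocity `v`.  The velocity is recorded as a
vector of the model space `E`, to which every tangent space is definitionally equal; thus it can be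
compared at base points which are only propositionally equal. -/
def HasVelocity (I : ModelWithCorners ℝ E H) (γ : ℝ → N) (v : E) : Prop :=
  HasMFDerivAt 𝓘(ℝ, ℝ) I γ 0 (ContinuousLinearMap.toSpanSingleton ℝ v : ℝ →L[ℝ] E)

variable {I : ModelWithCorners ℝ E H} {J : ModelWithCorners ℝ E' H'} {γ : ℝ → N} {v : E}

theorem HasVelocity.unique {w : E} (h : HasVelocity I γ v) (h' : HasVelocity I γ w) : v = w := by
  have e : (ContinuousLinearMap.toSpanSingleton ℝ v : ℝ →L[ℝ] E) =
      ContinuousLinearMap.toSpanSingleton ℝ w := hasMFDerivAt_unique h h'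
  simpa using congrArg (fun T : ℝ →L[ℝ] E => T 1) e

theorem HasVelocity.congr {δ : ℝ → N} (h : HasVelocity I γ v) (e : δ =ᶠ[𝓝 0] γ) :
    HasVelocity I δ v :=
  HasMFDerivAt.congr_of_eventuallyEq h e

theorem HasVelocity.continuousAt (h : HasVelocity I γ v) : ContinuousAt γ 0 :=
  HasMFDerivAt.continuousAt h

theorem hasVelocity_const (n : N) : HasVelocity I (fun _ : ℝ => n) (0 : E) := by
  have := hasMFDerivAt_const (I := 𝓘(ℝ, ℝ)) (I' := I) n (0 : ℝ)
  unfold HasVelocity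
  rw [ContinuousLinearMap.toSpanSingleton_zero]
  exact this

theorem HasVelocity.prodMk {δ : ℝ → Q} {w : E'} (h : HasVelocity I γ v) (h' : HasVelocity J δ w) :
    HasVelocity (I.prod J) (fun t => (γ t, δ t)) (v, w) := by
  refine HasMFDerivAt.congr_mfderiv (HasMFDerivAt.prodMk h h') ?_
  exact ContinuousLinearMap.ext_ring (M₁ := E × E') rfl

theorem HasVelocity.comp {F : N → Q} {n : N} (h : HasVelocity I γ v) (h0 : γ 0 = n)
    (hF : MDifferentiableAt I J F n) :
    HasVelocity J (fun t => F (γ t)) (mfderiv I J F n v : E') := by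
  subst h0
  have := HasMFDerivAt.comp (0 : ℝ) hF.hasMFDerivAt h
  unfold HasVelocity
  refine HasMFDerivAt.congr_mfderiv this ?_
  refine ContinuousLinearMap.ext_ring ?_
  change mfderiv I J F (γ 0) ((1 : ℝ) • v : E) = (1 : ℝ) • (mfderiv I J F (γ 0) v : E')
  rw [one_smul, one_smul]

theorem HasVelocity.fst {γ : ℝ → N × Q} {v : E × E'} (h : HasVelocity (I.prod J) γ v) :
    HasVelocity I (fun t => (γ t).1) v.1 := by
  have := HasVelocity.comp (F := Prod.fst) h rfl (mdifferentiableAt_fst (I := I) (I' := J))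
  rwa [mfderiv_fst] at this

/-- Transport along an equality of base points does not change a tangent vector, seen as a vector of
the model space. -/
theorem tangentSpace_cast_apply {q q' : Q} (h : q = q') (v : TangentSpace J q) :
    (LinearEquiv.cast (R := ℝ) (M := fun q : Q => TangentSpace J q) h v : E') = v := by
  subst h
  rfl

/-- The differential of a smooth map on a subset, applied to the velocity of a curve in the subset,
is the velocity of the image curve.  In particular it does not depend on the chosen extension. -/
theorem HasVelocity.subsetDeriv {S : Set N} {f : S → Q} {x : S} {c : ℝ → S}
    (hc : HasVelocity I (fun t => (c t : N)) v) (h0 : c 0 = x)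
    (hf : ∃ F : N → Q, IsLocalExtension I J f x F) :
    HasVelocity J (fun t => f (c t)) (subsetDeriv I J f x v : E') := by
  have h0' : (c 0 : N) = x := congrArg Subtype.val h0
  obtain ⟨U, hU, hxU, hF, hFf⟩ := hf.choose_spec
  have hd : MDifferentiableAt I J hf.choose (x : N) :=
    (hF.contMDiffAt (hU.mem_nhds hxU)).mdifferentiableAt (by simp)
  have hev : ∀ᶠ t in 𝓝 (0 : ℝ), (c t : N) ∈ U :=
    hc.continuousAt (hU.mem_nhds (by rw [h0']; exact hxU))
  have key := (hc.comp h0' hd).congr (δ := fun t => f (c t))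
    (hev.mono fun t ht => (hFf (c t) ht).symm)
  have e : (_root_.subsetDeriv I J f x v : E') = mfderiv I J hf.choose (x : N) v := by
    unfold _root_.subsetDeriv
    rw [dif_pos hf]
    exact tangentSpace_cast_apply (J := J) hf.choose_spec.apply_eq
      (mfderiv I J hf.choose (x : N) v)
  rwa [e]

end Curves

/-! ### Curves in the fibres of a submersion -/

section Submersions

open Filter Topology

variable {E N E' Q : Type*}
  [NormedAddCommGroup E] [NormedSpace ℝ E] [TopologicalSpace N] [ChartedSpace E N]
  [NormedAddCommGroup E'] [NormedSpace ℝ E'] [TopologicalSpace Q] [ChartedSpace E' Q]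

/-- Vectors in the kernel of the differential of a submersion are velocities of curves in the fibre:
in the charts of the local normal form, of straight lines. -/
theorem Manifold.IsSubmersionAt.exists_curve_in_fiber [IsManifold 𝓘(ℝ, E) ∞ N]
    [IsManifold 𝓘(ℝ, E') ∞ Q] {f : N → Q} {n : N}
    (h : Manifold.IsSubmersionAt 𝓘(ℝ, E) 𝓘(ℝ, E') ∞ f n) {q : Q} (hq : f n = q) (v : E)
    (hv : mfderiv 𝓘(ℝ, E) 𝓘(ℝ, E') f n v = 0) :
    ∃ c : ℝ → {y | f y = q}, c 0 = ⟨n, hq⟩ ∧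
      HasVelocity 𝓘(ℝ, E) (fun t => (c t : N)) v := by
  subst hq
  have hn := h.mem_domChart_source
  have hfn := h.mem_codChart_source
  have hφ := h.domChart_mem_maximalAtlas
  have hψ := h.codChart_mem_maximalAtlas
  have hmaps := h.source_subset_preimage_source
  have hwr := h.writtenInCharts
  set φ := h.domChart
  set ψ := h.codChart
  have hφd : MDifferentiableAt 𝓘(ℝ, E) 𝓘(ℝ, E) φ n :=
    (contMDiffAt_of_mem_maximalAtlas hφ hn).mdifferentiableAt (by simp)
  have hφsd : MDifferentiableAt 𝓘(ℝ, E) 𝓘(ℝ, E) φ.symm (φ n) :=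
    (contMDiffAt_symm_of_mem_maximalAtlas hφ (φ.map_source hn)).mdifferentiableAt (by simp)
  have hψd : MDifferentiableAt 𝓘(ℝ, E') 𝓘(ℝ, E') ψ (f n) :=
    (contMDiffAt_of_mem_maximalAtlas hψ hfn).mdifferentiableAt (by simp)
  have hfd : MDifferentiableAt 𝓘(ℝ, E) 𝓘(ℝ, E') f n := h.contMDiffAt.mdifferentiableAt (by simp)
  -- the local normal form, without the extended charts
  have hnf : ∀ y ∈ φ.target, ψ (f (φ.symm y)) = (h.equiv y).1 := fun y hy => by
    simpa using hwr (x := y) (by simpa using hy)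
  let L : E →L[ℝ] E' := (ContinuousLinearMap.fst ℝ E' h.complement).comp (h.equiv : E →L[ℝ] _)
  let w : E := mfderiv 𝓘(ℝ, E) 𝓘(ℝ, E) φ n v
  have hσ : HasVelocity 𝓘(ℝ, E) (fun t : ℝ => φ n + t • w) w := by
    have h1 : HasDerivAt (fun t : ℝ => φ n + t • w) w 0 := by
      simpa using ((hasDerivAt_id (0 : ℝ)).smul_const w).const_add (φ n)
    exact h1.hasFDerivAt.hasMFDerivAt
  have hσ0 : (fun t : ℝ => φ n + t • w) 0 = φ n := by simp
  have hev : ∀ᶠ t in 𝓝 (0 : ℝ), φ n + t • w ∈ φ.target :=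
    hσ.continuousAt (φ.open_target.mem_nhds (by simpa using φ.map_source hn))
  have hw : mfderiv 𝓘(ℝ, E) 𝓘(ℝ, E) φ.symm (φ n) w = v := by
    have h1 := mfderiv_comp n hφsd hφd
    have h2 : (φ.symm ∘ φ) =ᶠ[𝓝 n] id := φ.eventually_left_inverse hn
    rw [h2.mfderiv_eq, mfderiv_id] at h1
    exact (congrArg (fun T : E →L[ℝ] E => T v) h1).symm
  have hγ := hσ.comp hσ0 hφsd
  rw [hw] at hγ
  -- `w` is tangent to the fibre of the projection `L`: both sides of `hnf` along the line
  -- `φ n + t • w` are curves, with velocities `dψ (df v) = 0` and `L w`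
  have hLw : L w = 0 := by
    have hγ0 : φ.symm ((fun t : ℝ => φ n + t • w) 0) = n := by rw [hσ0]; exact φ.left_inv hn
    have h1 := (hγ.comp hγ0 hfd).comp (congrArg f hγ0) hψd
    have h2 := hσ.comp hσ0 (F := L) (J := 𝓘(ℝ, E')) L.differentiableAt.mdifferentiableAt
    have h3 := (h1.congr (hev.mono fun t ht => (hnf _ ht).symm)).unique h2
    rw [mfderiv_eq_fderiv, L.fderiv, hv, map_zero] at h3
    exact h3.symm
  have hfib : ∀ t : ℝ, φ n + t • w ∈ φ.target → f (φ.symm (φ n + t • w)) = f n := fun t ht => by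
    refine ψ.injOn (hmaps (φ.map_target ht)) hfn ?_
    have h1 := hnf _ ht
    have h2 := hnf _ (φ.map_source hn)
    rw [φ.left_inv hn] at h2
    rw [h1, h2]
    change L (φ n + t • w) = L (φ n)
    rw [map_add, map_smul, hLw, smul_zero, add_zero]
  -- outside the chart domain the curve is given a constant value, so that it is defined for all `t`
  classical
  refine ⟨fun t => if ht : φ n + t • w ∈ φ.target then ⟨φ.symm (φ n + t • w), hfib t ht⟩
    else ⟨n, rfl⟩, ?_, hγ.congr ?_⟩
  · simp [φ.map_source hn, φ.left_inv hn]
  · filter_upwards [hev] with t ht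
    simp [ht]

end Submersions

/-! ### The infinitesimal action of a principal bundle -/

section Principal

variable {EG G EX X EP P EM M : Type*}
  [NormedAddCommGroup EG] [NormedSpace ℝ EG] [TopologicalSpace G] [ChartedSpace EG G]
  [NormedAddCommGroup EX] [NormedSpace ℝ EX] [TopologicalSpace X] [ChartedSpace EX X]
  [NormedAddCommGroup EP] [NormedSpace ℝ EP] [TopologicalSpace P] [ChartedSpace EP P]
  [NormedAddCommGroup EM] [NormedSpace ℝ EM] [TopologicalSpace M] [ChartedSpace EM M]
  {𝒢 : LieGroupoid EG G EX X} (A : 𝒢.Action EP P)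

namespace LieGroupoid.Action

/-- The unit `1_{μ p}`, as a point of the source fibre over `μ p`. -/
def unitArrow (p : P) : {g : G | 𝒢.s g = A.μ p} :=
  ⟨𝒢.u (A.μ p), 𝒢.s_u _⟩

theorem orbitMap_unitArrow (p : P) : A.orbitMap p (A.unitArrow p) = p :=
  A.u_smul p

theorem exists_isLocalExtension_orbitMap (p : P) (g : {g : G | 𝒢.s g = A.μ p}) :
    ∃ F : G → P, IsLocalExtension 𝓘(ℝ, EG) 𝓘(ℝ, EP) (A.orbitMap p) g F := by
  obtain ⟨F, U, hU, hg, hF, hFs⟩ := A.smooth_smul ⟨(g, p), g.2⟩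
  have hi : ContMDiff 𝓘(ℝ, EG) (𝓘(ℝ, EG).prod 𝓘(ℝ, EP)) ∞ (fun h : G => (h, p)) :=
    contMDiff_id.prodMk contMDiff_const
  exact ⟨fun h => F (h, p), (fun h => (h, p)) ⁻¹' U, hU.preimage hi.continuous, hg,
    hF.comp hi.contMDiffOn fun _ h => h, fun h hh => hFs ⟨(h, p), h.2⟩ hh⟩

variable {A} {p : P} {c : ℝ → {g : G | 𝒢.s g = A.μ p}} {v : EG}

theorem hasVelocity_orbitMap (h0 : c 0 = A.unitArrow p)
    (hc : HasVelocity 𝓘(ℝ, EG) (fun t => (c t : G)) v) (hv : v ∈ 𝒢.algebroidFiber (A.μ p)) :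
    HasVelocity 𝓘(ℝ, EP) (fun t => A.orbitMap p (c t))
      (A.infinitesimalAction p ⟨v, hv⟩ : EP) := by
  have h := hc.subsetDeriv h0 (A.exists_isLocalExtension_orbitMap p (A.unitArrow p))
  have e : (A.infinitesimalAction p ⟨v, hv⟩ : EP) =
      subsetDeriv 𝓘(ℝ, EG) 𝓘(ℝ, EP) (A.orbitMap p) (A.unitArrow p) v :=
    tangentSpace_cast_apply (J := 𝓘(ℝ, EP)) (A.u_smul p) _
  rwa [e]

/-- The velocity of an orbit curve computed with the differential of the whole action, instead of the
differential of the orbit map as in `hasVelocity_orbitMap`; by uniqueness of velocities,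
`a_p α = d(g p)(α, 0)`. -/
theorem hasVelocity_smul (h0 : c 0 = A.unitArrow p)
    (hc : HasVelocity 𝓘(ℝ, EG) (fun t => (c t : G)) v) :
    HasVelocity 𝓘(ℝ, EP) (fun t => A.orbitMap p (c t))
      (subsetDeriv (𝓘(ℝ, EG).prod 𝓘(ℝ, EP)) 𝓘(ℝ, EP) A.smul
        ⟨(𝒢.u (A.μ p), p), 𝒢.s_u _⟩ ((v, 0) : EG × EP) : EP) := by
  have hcp := hc.prodMk (J := 𝓘(ℝ, EP)) (hasVelocity_const p)
  refine HasVelocity.subsetDeriv (S := fiberProd 𝒢.s A.μ)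
    (c := fun t => ⟨((c t : G), p), (c t).2⟩) hcp ?_ (A.smooth_smul _)
  exact Subtype.ext (Prod.ext (congrArg Subtype.val h0) rfl)

variable {F : Type*} [NormedAddCommGroup F] [NormedSpace ℝ F]
  {V : X → Type*} [TopologicalSpace (Bundle.TotalSpace F V)] [∀ x, AddCommGroup (V x)]
  [∀ x, Module ℝ (V x)] [∀ x, TopologicalSpace (V x)] [FiberBundle F V]

/-- Vectors in `A_x` are velocities of curves in the source fibre starting at the unit. -/
theorem exists_curve_of_mem_algebroidFiber [IsManifold 𝓘(ℝ, EG) ∞ G] [IsManifold 𝓘(ℝ, EX) ∞ X]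
    (hv : v ∈ 𝒢.algebroidFiber (A.μ p)) :
    ∃ c : ℝ → {g : G | 𝒢.s g = A.μ p}, c 0 = A.unitArrow p ∧
      HasVelocity 𝓘(ℝ, EG) (fun t => (c t : G)) v :=
  (𝒢.isSubmersion_s.isSubmersionAt _).exists_curve_in_fiber (𝒢.s_u _) v hv

/-- Multiplicativity tested on `(α, 0)` at `(1_{μ p}, p)`: the infinitesimal action carries the
kernel of `ω` on the Lie algebroid to the kernel of `θ`. -/
theorem IsMultiplicative.apply_infinitesimalAction_eq_zero_iff
    [IsManifold 𝓘(ℝ, EG) ∞ G] [IsManifold 𝓘(ℝ, EX) ∞ X] [IsManifold 𝓘(ℝ, EP) ∞ P]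
    {ρ : 𝒢.Representation F V} {om : PullbackOneForm EX F V EG 𝒢.t}
    {θ : PullbackOneForm EX F V EP A.μ} (hθ : A.IsMultiplicative ρ om θ)
    (hv : v ∈ 𝒢.algebroidFiber (A.μ p)) :
    θ.toFun p (A.infinitesimalAction p ⟨v, hv⟩) = 0 ↔ om.toFun (𝒢.u (A.μ p)) v = 0 := by
  obtain ⟨c, h0, hc⟩ := exists_curve_of_mem_algebroidFiber (EG := EG) hv
  have e := (hasVelocity_orbitMap h0 hc hv).unique (hasVelocity_smul h0 hc)
  -- the base points `s 1_x` and `x` are only propositionally equal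
  have htan : ∀ {x y : X} (_ : x = y) (a b : EX), a = b →
      (⟨x, a⟩ : TangentBundle 𝓘(ℝ, EX) X) = ⟨y, b⟩ := by
    rintro x _ rfl a _ rfl
    rfl
  have hmul := hθ (𝒢.u (A.μ p)) p (𝒢.s_u _) v 0
    (htan (𝒢.s_u (A.μ p)) _ _ (hv.trans (map_zero (mfderiv 𝓘(ℝ, EP) 𝓘(ℝ, EX) A.μ p)).symm))
  rw [map_zero, map_zero, map_zero, add_zero] at hmul
  -- likewise for `1_{μ p} p` and `p`
  have hbase : ∀ {q q' : P} (_ : q = q') (w : EP), θ.toFun q w = 0 ↔ θ.toFun q' w = 0 := by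
    rintro q _ rfl w
    rfl
  refine (hbase (A.u_smul p).symm _).trans ?_
  rw [← hmul, LinearEquiv.map_eq_zero_iff]
  exact iff_of_eq (congrArg (fun w : EP => θ.toFun (A.smul ⟨(𝒢.u (A.μ p), p), 𝒢.s_u _⟩) w = 0) e)

variable {π : P → M}

/-- The action is free along the fibres of `π`, infinitesimally: a vector of the Lie algebroid is
recovered from its infinitesimal action by differentiating the inverse of `(g, p) ↦ (g p, p)`. -/
theorem IsPrincipal.infinitesimalAction_injective [IsManifold 𝓘(ℝ, EG) ∞ G]
    [IsManifold 𝓘(ℝ, EX) ∞ X] (hπ : A.IsPrincipal (EM := EM) π) (p : P) :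
    Function.Injective (A.infinitesimalAction p) := by
  obtain ⟨-, Ψ, hΨ, -, hΨs⟩ := hπ.diffeo
  rw [injective_iff_map_eq_zero]
  rintro ⟨v, hv⟩ hv0
  obtain ⟨c, h0, hc⟩ := exists_curve_of_mem_algebroidFiber (EG := EG) hv
  have hg := hasVelocity_orbitMap h0 hc hv
  rw [hv0] at hg
  have hgp := hg.prodMk (J := 𝓘(ℝ, EP)) (hasVelocity_const p)
  have h1 := HasVelocity.subsetDeriv (S := fiberProd π π)
    (c := fun t => ⟨(A.orbitMap p (c t), p), hπ.invariant ⟨(c t, p), (c t).2⟩⟩) hgp rfl (hΨs _)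
  have h2 := h1.fst
  -- the first component of the inverse diffeomorphism along the curve is the curve `c` itself
  have h3 : (fun t => (c t : G)) = fun t => (Ψ ⟨(A.orbitMap p (c t), p),
      hπ.invariant ⟨(c t, p), (c t).2⟩⟩ : G × P).1 := by
    funext t
    exact (congrArg (fun z : fiberProd 𝒢.s A.μ => z.1.1) (hΨ ⟨(c t, p), (c t).2⟩)).symm
  rw [← h3] at h2
  have h4 := hc.unique h2
  refine Subtype.ext (h4.trans ?_)
  exact congrArg Prod.fst (map_zero (subsetDeriv _ _ (fun y => (Ψ y : G × P)) _))

theorem IsPrincipal.mfderiv_infinitesimalAction [IsManifold 𝓘(ℝ, EG) ∞ G]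
    [IsManifold 𝓘(ℝ, EX) ∞ X] (hπ : A.IsPrincipal (EM := EM) π) (p : P)
    (α : 𝒢.algebroidFiber (A.μ p)) :
    mfderiv 𝓘(ℝ, EP) 𝓘(ℝ, EM) π p (A.infinitesimalAction p α) = 0 := by
  obtain ⟨v, hv⟩ := α
  obtain ⟨c, h0, hc⟩ := exists_curve_of_mem_algebroidFiber (EG := EG) hv
  have hp : A.orbitMap p (c 0) = p := by rw [h0, orbitMap_unitArrow]
  have h1 := (hasVelocity_orbitMap h0 hc hv).comp hp
    ((hπ.isSubmersion.isSubmersionAt p).contMDiffAt.mdifferentiableAt (by simp))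
  have h2 : (fun t => π (A.orbitMap p (c t))) = fun _ => π p :=
    funext fun t => hπ.invariant ⟨(c t, p), (c t).2⟩
  rw [h2] at h1
  exact h1.unique (hasVelocity_const (π p))

/-- A vertical vector is the velocity of a curve in a fibre of `π`; dividing that curve by its
starting point gives a curve of arrows, whose velocity is the required vector of the algebroid. -/
theorem IsPrincipal.exists_infinitesimalAction_eq [IsManifold 𝓘(ℝ, EP) ∞ P]
    [IsManifold 𝓘(ℝ, EM) ∞ M] (hπ : A.IsPrincipal (EM := EM) π) (p : P)
    (w : TangentSpace 𝓘(ℝ, EP) p) (hw : mfderiv 𝓘(ℝ, EP) 𝓘(ℝ, EM) π p w = 0) :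
    ∃ α, A.infinitesimalAction p α = w := by
  obtain ⟨-, Ψ, hΨ, hΨ', hΨs⟩ := hπ.diffeo
  obtain ⟨d, hd0, hd⟩ := (hπ.isSubmersion.isSubmersionAt p).exists_curve_in_fiber rfl w hw
  let y : ℝ → fiberProd π π := fun t => ⟨((d t : P), p), (d t).2⟩
  have hy : ∀ t, (A.smul (Ψ (y t)), (Ψ (y t)).1.2) = ((d t : P), p) := fun t =>
    congrArg Subtype.val (hΨ' (y t))
  have hs : ∀ t, 𝒢.s (Ψ (y t)).1.1 = A.μ p := fun t =>
    (Ψ (y t)).2.trans (congrArg A.μ (congrArg Prod.snd (hy t)))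
  let c : ℝ → {g : G | 𝒢.s g = A.μ p} := fun t => ⟨(Ψ (y t)).1.1, hs t⟩
  have hcd : ∀ t, A.orbitMap p (c t) = d t := fun t => by
    refine Eq.trans ?_ (congrArg Prod.fst (hy t))
    exact congrArg A.smul (Subtype.ext (Prod.ext rfl (congrArg Prod.snd (hy t)).symm))
  have hc0 : c 0 = A.unitArrow p := by
    refine Subtype.ext ?_
    have h1 : y 0 = ⟨(A.smul ⟨(𝒢.u (A.μ p), p), 𝒢.s_u _⟩, p), hπ.invariant _⟩ :=
      Subtype.ext (Prod.ext ((congrArg Subtype.val hd0).trans (A.u_smul p).symm) rfl)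
    change (Ψ (y 0)).1.1 = _
    rw [h1]
    exact congrArg (fun z : fiberProd 𝒢.s A.μ => z.1.1) (hΨ ⟨(𝒢.u (A.μ p), p), 𝒢.s_u _⟩)
  have hyv := hd.prodMk (J := 𝓘(ℝ, EP)) (hasVelocity_const p)
  have hc := (HasVelocity.subsetDeriv (c := y) hyv rfl (hΨs _)).fst
  have hsc := HasVelocity.comp (F := 𝒢.s) (J := 𝓘(ℝ, EX)) hc (congrArg Subtype.val hc0)
    ((𝒢.isSubmersion_s.isSubmersionAt _).contMDiffAt.mdifferentiableAt (by simp))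
  rw [funext hs] at hsc
  refine ⟨⟨_, hsc.unique (hasVelocity_const (A.μ p))⟩, ?_⟩
  have h1 := hasVelocity_orbitMap (c := c) hc0 hc (hsc.unique (hasVelocity_const (A.μ p)))
  rw [funext hcd] at h1
  exact h1.unique hd

end LieGroupoid.Action

end Principal

theorem mainTheorem5
    {EG G EX X EP P EM M : Type*}
    [NormedAddCommGroup EG] [NormedSpace ℝ EG] [FiniteDimensional ℝ EG]
    [TopologicalSpace G] [ChartedSpace EG G] [IsManifold 𝓘(ℝ, EG) ∞ G]
    [NormedAddCommGroup EX] [NormedSpace ℝ EX] [FiniteDimensional ℝ EX]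
    [TopologicalSpace X] [ChartedSpace EX X] [IsManifold 𝓘(ℝ, EX) ∞ X]
    [NormedAddCommGroup EP] [NormedSpace ℝ EP] [FiniteDimensional ℝ EP]
    [TopologicalSpace P] [ChartedSpace EP P] [IsManifold 𝓘(ℝ, EP) ∞ P]
    [NormedAddCommGroup EM] [NormedSpace ℝ EM] [FiniteDimensional ℝ EM]
    [TopologicalSpace M] [ChartedSpace EM M] [IsManifold 𝓘(ℝ, EM) ∞ M]
    {F : Type*} [NormedAddCommGroup F] [NormedSpace ℝ F] [FiniteDimensional ℝ F]
    {V : X → Type*} [TopologicalSpace (Bundle.TotalSpace F V)] [∀ x, AddCommGroup (V x)]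
    [∀ x, Module ℝ (V x)] [∀ x, TopologicalSpace (V x)] [FiberBundle F V] [VectorBundle ℝ F V]
    [ContMDiffVectorBundle ∞ F V 𝓘(ℝ, EX)]
    (𝒢 : LieGroupoid EG G EX X) (ρ : 𝒢.Representation F V)
    (om : PullbackOneForm EX F V EG 𝒢.t) (h_om : LieGroupoid.IsMultiplicativeForm ρ om)
    (A : 𝒢.Action EP P) (π : P → M) (hπ : A.IsPrincipal (EM := EM) π)
    (θ : PullbackOneForm EX F V EP A.μ) (hθ : A.IsMultiplicative ρ om θ) :
    ∀ p : P, ∃ e : 𝒢.symbolSpace om (A.μ p) ≃ₗ[ℝ] verticalKernel (EM := EM) θ π p,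
      ∀ α : 𝒢.symbolSpace om (A.μ p),
        (e α : TangentSpace 𝓘(ℝ, EP) p) =
          A.infinitesimalAction p (Submodule.inclusion inf_le_right α) := by
  intro p
  let a := A.infinitesimalAction p ∘ₗ
    Submodule.inclusion (inf_le_right : 𝒢.symbolSpace om (A.μ p) ≤ 𝒢.algebroidFiber (A.μ p))
  have hmem : ∀ α, a α ∈ verticalKernel (EM := EM) θ π p := fun α =>
    ⟨hπ.mfderiv_infinitesimalAction p _,
      (hθ.apply_infinitesimalAction_eq_zero_iff α.2.2).mpr α.2.1⟩
  refine ⟨LinearEquiv.ofBijective (a.codRestrict _ hmem) ⟨?_, ?_⟩, fun α => rfl⟩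
  · intro α β h
    exact Submodule.inclusion_injective _
      (hπ.infinitesimalAction_injective p (congrArg Subtype.val h))
  · rintro ⟨w, hw, hwθ⟩
    obtain ⟨⟨v, hv⟩, rfl⟩ := hπ.exists_infinitesimalAction_eq p w hw
    exact ⟨⟨v, (hθ.apply_infinitesimalAction_eq_zero_iff hv).mp hwθ, hv⟩, rfl⟩
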